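/- Let $E$ be a (real) Banach space. A \emph{measure of noncompactness} on $E$ is a map $\mu$ from the family of nonempty bounded subsets of $E$ to $[0,\infty)$ such that, for all nonempty bounded $B,C\subseteq E$: (1) $\mu(B)=0$ if and only if $B$ is precompact (i.e. $\overline{B}$ is compact); (2) $B\subseteq C$ implies $\mu(B)\le\mu(C)$; (3) $\mu(B)=\mu(\overline{B})$; (4) $\mu(\operatorname{Conv}B)=\mu(B)$, where $\operatorname{Conv}B$ is the closed convex hull of $B$; (5) $\mu(\lambda B+(1-\lambda)C)\le\lambda\mu(B)+(1-\lambda)\mu(C)$ for all $\lambda\in[0,1]$; (6) if $(B_n)_{n\ge 1}$ is a sequence of nonempty closed bounded sets with $B_{n+1}\subseteq B_n$ for all $n$ and $\lim_{n\to\infty}\mu(B_n)=0$, then $\bigcap_{n\ge 1}B_n$ is nonempty and precompact. \textbf{Theorem.} Let $E$ be a Banach space, $\mu$ a measure of noncompactness on $E$, $A\subseteq E$ a nonempty, closed, bounded and convex set, and $T:A\to A$ a continuous map. Let (i) $\Psi:[0,\infty)\to[0,\infty)$ be a nondecreasing concave function such that $\lim_{n\to\infty}\Psi^n(t)=0$ for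 every $t\ge 0$, where $\Psi^n$ denotes the $n$-th iterate; (ii) $\Phi:[0,\infty)\to[0,\infty)$ be a nondecreasing subadditive function such that $\Phi(t)\ge t$ for every $t\ge 0$ and such that, for every sequence $(x_n)$ in $[0,\infty)$, $\lim_{n\to\infty}\Phi(x_n)=0$ if and only if $\lim_{n\to\infty}x_n=0$; (iii) $\varphi:[0,\infty)\to[0,\infty)$ be Lebesgue integrable on each compact subset of $[0,\infty)$, with $\int_0^{\varepsilon}\varphi(\gamma)\,d\gamma>0$ for every $\varepsilon>0$. Suppose that for every nonempty subset $Y\subseteq A$, $$\Phi\left(\int_0^{\mu(TY)}\varphi(\gamma)\,d\gamma\right)\le\Psi\left(\int_0^{\mu(Y)}\varphi(\gamma)\,d\gamma\right).$$ Then $T$ has at least one fixed point in $A$. -/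

import Mathlib

open Set Filter Topology MeasureTheory
open scoped Pointwise

/-- `μ` is a measure of noncompactness on the Banach space `E`. It is a function on the family of
nonempty bounded subsets of `E`; its values on other sets are irrelevant. (The empty set has to be
left out: it is relatively compact, so `eq_zero_iff` would give it the value `0`, and the constant
sequence `∅` would contradict `iInter_nonempty`.) -/
structure IsMeasureOfNoncompactness {E : Type*} [NormedAddCommGroup E] [NormedSpace ℝ E]
    (μ : Set E → ℝ) : Prop where
  nonneg : ∀ A : Set E, A.Nonempty → Bornology.IsBounded A → 0 ≤ μ A
  eq_zero_iff : ∀ A : Set E, A.Nonempty → Bornology.IsBounded A →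
    (μ A = 0 ↔ IsCompact (closure A))
  mono : ∀ A B : Set E, A.Nonempty → Bornology.IsBounded B → A ⊆ B → μ A ≤ μ B
  closure_eq : ∀ A : Set E, A.Nonempty → Bornology.IsBounded A → μ A = μ (closure A)
  closedConvexHull_eq : ∀ A : Set E, A.Nonempty → Bornology.IsBounded A →
    μ (closedConvexHull ℝ A) = μ A
  convex : ∀ A B : Set E, A.Nonempty → Bornology.IsBounded A → B.Nonempty →
    Bornology.IsBounded B → ∀ l : ℝ, l ∈ Icc (0 : ℝ) 1 →
      μ (l • A + (1 - l) • B) ≤ l * μ A + (1 - l) * μ B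
  iInter_nonempty : ∀ A : ℕ → Set E, (∀ n, (A n).Nonempty) →
    (∀ n, Bornology.IsBounded (A n)) → (∀ n, IsClosed (A n)) → (∀ n, A (n + 1) ⊆ A n) →
    Tendsto (fun n => μ (A n)) atTop (𝓝 0) →
      (⋂ n, A n).Nonempty ∧ IsCompact (closure (⋂ n, A n))

/-! Put `B 0 = A` and let `B (n + 1)` be the closed convex hull of `T '' B n`. These sets are
closed, convex and decreasing. Write `I t` for the integral of `φ` over `[0, t]`. Since `t ≤ Φ t`
and `μ` ignores closed convex hulls, the hypothesis gives `I (μ (B (n + 1))) ≤ Ψ (I (μ (B n)))`, so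
`I (μ (B n)) ≤ Ψ^[n] (I (μ A))`, which tends to zero. As `I` is monotone and positive at every
positive argument, `μ (B n)` tends to zero, and the intersection of the `B n` is nonempty, compact,
convex and invariant under `T`. Schauder's theorem (`exists_fixedPoint_of_isCompact_convex`)
finishes the proof.

Schauder's theorem is reduced to Brouwer's on a simplex by projecting onto the hull of a finite net,
and Brouwer's theorem is the limit of a statement about coloured grids, `exists_colourful_cluster`.
The combinatorial core is Scarf's lemma, `exists_colourful_dominant`, a parity argument on dominant
sets that plays the role of Sperner's lemma without any triangulation. -/

/-- A finite set `S` is dominant for the family of orders induced by `r i` if every point lies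
weakly below all of `S` in at least one of the orders. -/
def IsDominantFor {I X : Type*} (r : I → X → ℕ) (S : Finset X) : Prop :=
  ∀ y, ∃ i, ∀ x ∈ S, r i y ≤ r i x

/-! ### Scarf's lemma by double counting -/

section Scarf

variable {I X : Type*} {r : I → X → ℕ}

theorem IsDominantFor.mono {S D : Finset X} (hS : IsDominantFor r S) (h : D ⊆ S) :
    IsDominantFor r D := fun y =>
  let ⟨i, hi⟩ := hS y
  ⟨i, fun x hx => hi x (h hx)⟩

theorem exists_forall_mem_minimizer (r : I → X → ℕ) {S : Finset X} (hS : S.Nonempty) :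
    ∃ m : I → X, (∀ i, m i ∈ S) ∧ ∀ i, ∀ x ∈ S, r i (m i) ≤ r i x := by
  choose m hm hm' using fun i => S.exists_min_image (r i) hS
  exact ⟨m, hm, hm'⟩

/-- Dominance applied to `x` itself gives an order in which `x` is least in `S`; injectivity
identifies it with the minimizer. -/
theorem IsDominantFor.exists_minimizer_eq (hr : ∀ i, Function.Injective (r i)) {S : Finset X}
    (hS : IsDominantFor r S) {m : I → X} (hmS : ∀ i, m i ∈ S)
    (hm : ∀ i, ∀ x ∈ S, r i (m i) ≤ r i x) {x : X} (hx : x ∈ S) : ∃ i, m i = x := by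
  obtain ⟨i, hi⟩ := hS x
  exact ⟨i, hr i (le_antisymm (hm i x hx) (hi _ (hmS i)))⟩

variable [Fintype I] [DecidableEq I] [DecidableEq X]

/-- The minimizers of a dominant set with one element less than there are orders coincide for
exactly one pair of orders. -/
theorem exists_unique_collision {D : Finset X} (hcard : D.card + 1 = Fintype.card I) {m : I → X}
    (hmD : ∀ i, m i ∈ D) (hsurj : ∀ x ∈ D, ∃ i, m i = x) :
    ∃ j k, j ≠ k ∧ m j = m k ∧ Set.InjOn m {j}ᶜ ∧ Set.InjOn m {k}ᶜ := by
  obtain ⟨j, -, k, -, hjk, hm⟩ := Finset.exists_ne_map_eq_of_card_lt_of_maps_to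
    (s := Finset.univ) (t := D) (f := m) (by rw [Finset.card_univ]; omega) (fun i _ => hmD i)
  -- Dropping `j` loses no value because `m j = m k`, so the remaining indices map onto a set with
  -- exactly as many elements.
  have key : ∀ j k, j ≠ k → m j = m k → Set.InjOn m {j}ᶜ := by
    intro j k hjk hm
    have himg : (Finset.univ.erase j).image m = D := by
      ext x
      simp only [Finset.mem_image, Finset.mem_erase, Finset.mem_univ, and_true]
      constructor
      · rintro ⟨i, -, rfl⟩
        exact hmD i
      · intro hx
        obtain ⟨i, rfl⟩ := hsurj x hx
        by_cases hi : i = j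
        · exact ⟨k, hjk.symm, by rw [hi, hm]⟩
        · exact ⟨i, hi, rfl⟩
    have := Finset.injOn_of_card_image_eq (s := Finset.univ.erase j) (f := m) (by
      rw [himg, Finset.card_erase_of_mem (Finset.mem_univ _), Finset.card_univ]; omega)
    intro a ha b hb
    exact this (by simpa using ha) (by simpa using hb)
  exact ⟨j, k, hjk, hm, key j k hjk hm, key k j hjk.symm hm.symm⟩

/-- Adding to `D` the `j`-largest point above the other minimizers keeps `D` dominant. -/
theorem IsDominantFor.insert_of_maximal {D : Finset X} (hD : IsDominantFor r D) {m : I → X}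
    (hm : ∀ i, ∀ x ∈ D, r i (m i) ≤ r i x) (hmD : ∀ i, m i ∈ D) {j : I} {y : X}
    (hy : ∀ i, i ≠ j → r i (m i) < r i y)
    (hmax : ∀ z, (∀ i, i ≠ j → r i (m i) < r i z) → r j z ≤ r j y) :
    IsDominantFor r (insert y D) := by
  intro z
  by_cases hz : ∀ i, i ≠ j → r i (m i) < r i z
  · refine ⟨j, fun x hx => ?_⟩
    rcases Finset.mem_insert.1 hx with rfl | hx
    · exact hmax z hz
    · obtain ⟨i, hi⟩ := hD z
      -- In every order other than `j`, the point `z` lies strictly above a point of `D`.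
      have hij : i = j := by
        by_contra h
        exact absurd (hz i h) (not_lt.2 (hi _ (hmD i)))
      exact hij ▸ hi x hx
  · push Not at hz
    obtain ⟨i, hij, hi⟩ := hz
    refine ⟨i, fun x hx => ?_⟩
    rcases Finset.mem_insert.1 hx with rfl | hx
    · exact hi.trans (hy i hij).le
    · exact hi.trans (hm i x hx)

/-- If `D ∪ {y}` is dominant of full cardinality, then `y` is minimal in exactly one order `i`,
and it is `i`-largest among the points above all the other minimizers of `D`. -/
theorem IsDominantFor.exists_order_of_insert (hr : ∀ i, Function.Injective (r i)) {D : Finset X}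
    (hcard : D.card + 1 = Fintype.card I) {m : I → X}
    (hm : ∀ i, ∀ x ∈ D, r i (m i) ≤ r i x) (hmD : ∀ i, m i ∈ D) {y : X} (hyD : y ∉ D)
    (hS : IsDominantFor r (insert y D)) :
    ∃ i, Set.InjOn m {i}ᶜ ∧ (∀ l, l ≠ i → r l (m l) < r l y) ∧
      ∀ z, (∀ l, l ≠ i → r l (m l) < r l z) → r i z ≤ r i y := by
  obtain ⟨M, hMS, hM⟩ := exists_forall_mem_minimizer r (Finset.insert_nonempty y D)
  have hsurj := fun x (hx : x ∈ insert y D) => hS.exists_minimizer_eq hr hMS hM hx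
  have himg : Finset.univ.image M = insert y D := by
    ext x
    simp only [Finset.mem_image, Finset.mem_univ, true_and]
    exact ⟨by rintro ⟨i, rfl⟩; exact hMS i, hsurj x⟩
  have hMinj := Finset.injOn_of_card_image_eq (s := Finset.univ) (f := M) (by
    rw [himg, Finset.card_insert_of_notMem hyD, Finset.card_univ]; omega)
  obtain ⟨i, hi⟩ := hsurj y (Finset.mem_insert_self _ _)
  have hMD : ∀ l, l ≠ i → M l ∈ D := fun l hl =>
    (Finset.mem_insert.1 (hMS l)).resolve_left fun h =>
      hl (hMinj (Finset.mem_coe.2 (Finset.mem_univ _)) (Finset.mem_coe.2 (Finset.mem_univ _))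
        (h.trans hi.symm))
  have hMm : ∀ l, l ≠ i → M l = m l := fun l hl =>
    hr l (le_antisymm (hM l _ (Finset.mem_insert_of_mem (hmD l))) (hm l _ (hMD l hl)))
  refine ⟨i, ?_, ?_, ?_⟩
  · intro a ha b hb hab
    rw [← hMm a ha, ← hMm b hb] at hab
    exact hMinj (by simp) (by simp) hab
  · intro l hl
    refine lt_of_le_of_ne ?_ ?_
    · rw [← hMm l hl]
      exact hM l y (Finset.mem_insert_self _ _)
    · intro h
      exact hyD (hr l h ▸ hmD l)
  · intro z hz
    obtain ⟨l, hl⟩ := hS z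
    have hli : l = i := by
      by_contra h
      exact absurd (hz l h) (not_lt.2 (hl _ (Finset.mem_insert_of_mem (hmD l))))
    exact hli ▸ hl y (Finset.mem_insert_self _ _)

/-- A set of full cardinality that is not colourful has an even number of facets carrying all
colours but `a`. -/
theorem even_card_facets (c : X → I) (a : I) {S : Finset X} (hS : S.card = Fintype.card I)
    (hc : S.image c ≠ Finset.univ) :
    Even (S.powerset.filter fun D => D.image c = Finset.univ.erase a ∧
      D.card + 1 = Fintype.card I).card := by
  rcases Finset.eq_empty_or_nonempty (S.powerset.filter fun D =>
    D.image c = Finset.univ.erase a ∧ D.card + 1 = Fintype.card I) with h | ⟨D, hD⟩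
  · rw [h]; simp
  have hinj : ∀ D : Finset X, D.image c = Finset.univ.erase a → D.card + 1 = Fintype.card I →
      Set.InjOn c D := fun D h h' => Finset.injOn_of_card_image_eq (by
    rw [h, Finset.card_erase_of_mem (Finset.mem_univ _), Finset.card_univ]; omega)
  simp only [Finset.mem_filter, Finset.mem_powerset] at hD
  obtain ⟨hDS, hDc, hDcard⟩ := hD
  obtain ⟨x, hxD, rfl⟩ := (Finset.covBy_iff_exists_insert.1
    (Finset.covBy_iff_card_sdiff_eq_one.2 ⟨hDS, by
      rw [Finset.card_sdiff_of_subset hDS]; omega⟩))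
  have hxa : c x ≠ a := by
    rintro rfl
    exact hc (by rw [Finset.image_insert, hDc, Finset.insert_erase (Finset.mem_univ _)])
  -- The colour of `x` is repeated exactly once, at `x'`. A facet with the required colours must
  -- omit one of the two, so there are exactly two such facets.
  obtain ⟨x', hx'D, hx'⟩ : ∃ x' ∈ D, c x' = c x := by
    have : c x ∈ D.image c := by rw [hDc]; simp [hxa]
    simpa using this
  have hxx' : x ≠ x' := by rintro rfl; exact hxD hx'D
  have hD' : ((insert x D).erase x').image c = Finset.univ.erase a ∧
      ((insert x D).erase x').card + 1 = Fintype.card I := by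
    constructor
    · rw [← hDc]
      ext i
      simp only [Finset.mem_image, Finset.mem_erase, Finset.mem_insert]
      constructor
      · rintro ⟨z, ⟨-, rfl | hz⟩, rfl⟩
        · exact ⟨x', hx'D, hx'⟩
        · exact ⟨z, hz, rfl⟩
      · rintro ⟨z, hz, rfl⟩
        by_cases hzx : z = x'
        · exact ⟨x, ⟨hxx', Or.inl rfl⟩, by rw [hzx, hx']⟩
        · exact ⟨z, ⟨hzx, Or.inr hz⟩, rfl⟩
    · rw [Finset.card_erase_add_one (Finset.mem_insert_of_mem hx'D), hS]
  have hset : ((insert x D).powerset.filter fun D => D.image c = Finset.univ.erase a ∧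
      D.card + 1 = Fintype.card I) = {D, (insert x D).erase x'} := by
    ext B
    simp only [Finset.mem_filter, Finset.mem_powerset, Finset.mem_insert, Finset.mem_singleton]
    constructor
    · rintro ⟨hB, hBc, hBcard⟩
      obtain ⟨z, hz, hzB⟩ := (Finset.covBy_iff_exists_insert.1
        (Finset.covBy_iff_card_sdiff_eq_one.2 ⟨hB, by
          rw [Finset.card_sdiff_of_subset hB]; omega⟩))
      have hBe : B = (insert x D).erase z := by rw [← hzB, Finset.erase_insert hz]
      by_cases h1 : z = x
      · left; rw [hBe, h1, Finset.erase_insert hxD]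
      by_cases h2 : z = x'
      · right; rw [hBe, h2]
      exfalso
      refine hxx' (hinj B hBc hBcard ?_ ?_ hx'.symm)
      · rw [hBe]; simp [Ne.symm h1]
      · rw [hBe]; simp [Ne.symm h2, hx'D]
    · rintro (rfl | rfl)
      · exact ⟨Finset.subset_insert _ _, hDc, hDcard⟩
      · exact ⟨Finset.erase_subset _ _, hD'⟩
  rw [hset, Finset.card_pair]
  · exact even_two
  · intro h
    have := h ▸ hx'D
    simp at this

variable [Fintype X]

open Classical in
/-- A dominant set of one less than full cardinality lies in exactly two dominant sets of full
cardinality, provided that for every order there are points above all other minimizers. -/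
theorem card_dominant_supersets_eq_two (hr : ∀ i, Function.Injective (r i)) {D : Finset X}
    (hD : IsDominantFor r D) (hDne : D.Nonempty) (hcard : D.card + 1 = Fintype.card I)
    (hup : ∀ j, ∃ z, ∀ i, i ≠ j → ∃ x ∈ D, r i x < r i z) :
    (Finset.univ.filter fun S : Finset X =>
      (IsDominantFor r S ∧ S.card = Fintype.card I) ∧ D ⊆ S).card = 2 := by
  obtain ⟨m, hmD, hm⟩ := exists_forall_mem_minimizer r hDne
  have hsurj := fun x (hx : x ∈ D) => hD.exists_minimizer_eq hr hmD hm hx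
  obtain ⟨j, k, hjk, hmjk, hj, hk⟩ := exists_unique_collision hcard hmD hsurj
  have hmax : ∀ l, ∃ y, (∀ i, i ≠ l → r i (m i) < r i y) ∧
      ∀ z, (∀ i, i ≠ l → r i (m i) < r i z) → r l z ≤ r l y := by
    intro l
    obtain ⟨z, hz⟩ := hup l
    obtain ⟨y, hy, hy'⟩ := (Finset.univ.filter fun z =>
      ∀ i, i ≠ l → r i (m i) < r i z).exists_max_image (r l) ⟨z, by
        simp only [Finset.mem_filter, Finset.mem_univ, true_and]
        intro i hi
        obtain ⟨x, hx, hxz⟩ := hz i hi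
        exact (hm i x hx).trans_lt hxz⟩
    simp only [Finset.mem_filter, Finset.mem_univ, true_and] at hy hy'
    exact ⟨y, hy, hy'⟩
  have hnot : ∀ y, ∃ i, r i y ≤ r i (m i) := fun y =>
    let ⟨i, hi⟩ := hD y
    ⟨i, hi _ (hmD i)⟩
  obtain ⟨u, hu, hu'⟩ := hmax j
  obtain ⟨v, hv, hv'⟩ := hmax k
  -- A point of `D` is some `m i`, so it cannot exceed `m i` in order `i`. The excluded order `l` is
  -- no escape, as `m l` is also `m l'`.
  have hnotmem : ∀ {l l' y}, l ≠ l' → m l = m l' → (∀ i, i ≠ l → r i (m i) < r i y) → y ∉ D := by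
    intro l l' y hl hml hy hyD
    obtain ⟨i, rfl⟩ := hsurj y hyD
    by_cases hi : i = l
    · subst hi
      have := hy l' hl.symm
      rw [hml] at this
      exact lt_irrefl _ this
    · exact lt_irrefl _ (hy i hi)
  have huD := hnotmem hjk hmjk hu
  have hvD := hnotmem hjk.symm hmjk.symm hv
  -- A common point would exceed `m i` in every order `i`, against the dominance of `D`.
  have huv : u ≠ v := by
    rintro rfl
    obtain ⟨i, hi⟩ := hnot u
    by_cases h : i = j
    · exact absurd (hv i (h ▸ hjk)) (not_lt.2 hi)
    · exact absurd (hu i h) (not_lt.2 hi)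
  have hset : (Finset.univ.filter fun S : Finset X =>
      (IsDominantFor r S ∧ S.card = Fintype.card I) ∧ D ⊆ S) = {insert u D, insert v D} := by
    ext S
    simp only [Finset.mem_filter, Finset.mem_univ, true_and, Finset.mem_insert,
      Finset.mem_singleton]
    constructor
    · rintro ⟨⟨hS, hSc⟩, hDS⟩
      obtain ⟨y, hyD, rfl⟩ := (Finset.covBy_iff_exists_insert.1
        (Finset.covBy_iff_card_sdiff_eq_one.2 ⟨hDS, by
          rw [Finset.card_sdiff_of_subset hDS]; omega⟩))
      obtain ⟨i, hinj, hy, hy'⟩ := hS.exists_order_of_insert hr hcard hm hmD hyD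
      have hi : i = j ∨ i = k := by
        by_contra! h
        exact hjk (hinj h.1.symm h.2.symm hmjk)
      rcases hi with rfl | rfl
      · exact Or.inl (by rw [hr i (le_antisymm (hu' y hy) (hy' u hu))])
      · exact Or.inr (by rw [hr i (le_antisymm (hv' y hy) (hy' v hv))])
    · rintro (rfl | rfl)
      · exact ⟨⟨hD.insert_of_maximal hm hmD hu hu', by
          rw [Finset.card_insert_of_notMem huD, hcard]⟩, Finset.subset_insert _ _⟩
      · exact ⟨⟨hD.insert_of_maximal hm hmD hv hv', by
          rw [Finset.card_insert_of_notMem hvD, hcard]⟩, Finset.subset_insert _ _⟩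
  rw [hset, Finset.card_pair]
  intro h
  have : u ∈ insert v D := h ▸ Finset.mem_insert_self _ _
  exact (Finset.mem_insert.1 this).elim huv huD

open Classical in
/-- The facet of all slack points but one lies in exactly one dominant set of full cardinality. -/
theorem card_dominant_supersets_slack (hr : ∀ i, Function.Injective (r i)) {s : I → X}
    (hs : Function.Injective s) (hmin : ∀ i x, r i (s i) ≤ r i x)
    (htop : ∀ i j x, i ≠ j → x ∉ Set.range s → r i x < r i (s j))
    (hne : ∃ x, x ∉ Set.range s) (a : I) :
    (Finset.univ.filter fun S : Finset X => (IsDominantFor r S ∧ S.card = Fintype.card I) ∧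
      (Finset.univ.erase a).image s ⊆ S).card = 1 := by
  have hlt : ∀ i x, x ∉ Set.range s → r i (s i) < r i x := fun i x hx =>
    lt_of_le_of_ne (hmin i x) fun h => hx ⟨i, hr i h⟩
  have hpos : 0 < Fintype.card I := Fintype.card_pos_iff.2 ⟨a⟩
  have hcard : ((Finset.univ.erase a).image s).card + 1 = Fintype.card I := by
    rw [Finset.card_image_of_injective _ hs, Finset.card_erase_of_mem (Finset.mem_univ _),
      Finset.card_univ]
    omega
  obtain ⟨t, ht⟩ := hne
  obtain ⟨u, hu, hu'⟩ := (Finset.univ.filter fun x => x ∉ Set.range s).exists_max_image (r a)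
    ⟨t, by simpa using ht⟩
  simp only [Finset.mem_filter, Finset.mem_univ, true_and] at hu hu'
  rw [Finset.card_eq_one]
  refine ⟨insert u ((Finset.univ.erase a).image s), ?_⟩
  ext S
  simp only [Finset.mem_filter, Finset.mem_univ, true_and, Finset.mem_singleton]
  constructor
  · rintro ⟨⟨hS, hSc⟩, hDS⟩
    obtain ⟨y, hyD, rfl⟩ := (Finset.covBy_iff_exists_insert.1
      (Finset.covBy_iff_card_sdiff_eq_one.2 ⟨hDS, by
        rw [Finset.card_sdiff_of_subset hDS]; omega⟩))
    -- A non-slack point lies strictly above `s i` in order `i`, so only order `a` can witness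
    -- dominance. This forces `y` to be the `a`-largest non-slack point.
    have hle : ∀ z, z ∉ Set.range s → r a z ≤ r a y := by
      intro z hz
      obtain ⟨i, hi⟩ := hS z
      have : i = a := by
        by_contra h
        exact absurd (hlt i z hz) (not_lt.2 (hi _ (Finset.mem_insert_of_mem
          (Finset.mem_image_of_mem s (by simp [h])))))
      exact this ▸ hi y (Finset.mem_insert_self _ _)
    have hy : y ∉ Set.range s := by
      rintro ⟨i, rfl⟩
      have : i = a := by
        by_contra h
        exact hyD (Finset.mem_image_of_mem s (by simp [h]))
      subst this
      exact absurd (hlt i t ht) (not_lt.2 (hle t ht))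
    rw [hr a (le_antisymm (hle u hu) (hu' y hy))]
  · rintro rfl
    have huD : u ∉ (Finset.univ.erase a).image s := by
      intro h
      obtain ⟨i, -, rfl⟩ := Finset.mem_image.1 h
      exact hu ⟨i, rfl⟩
    refine ⟨⟨?_, by rw [Finset.card_insert_of_notMem huD, hcard]⟩, Finset.subset_insert _ _⟩
    intro z
    by_cases hz : z ∈ Set.range s
    · obtain ⟨i, rfl⟩ := hz
      exact ⟨i, fun x _ => hmin i x⟩
    · refine ⟨a, fun x hx => ?_⟩
      rcases Finset.mem_insert.1 hx with rfl | hx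
      · exact hu' z hz
      · obtain ⟨i, hi, rfl⟩ := Finset.mem_image.1 hx
        exact (htop a i z (Finset.ne_of_mem_erase hi).symm hz).le

/-- **Scarf's lemma**: for every colouring extending the tautological colouring of the slack
points there is a dominant set of full cardinality carrying all colours. -/
theorem exists_colourful_dominant [Nonempty I] (hr : ∀ i, Function.Injective (r i)) {s : I → X}
    (hmin : ∀ i x, r i (s i) ≤ r i x)
    (htop : ∀ i j x, i ≠ j → x ∉ Set.range s → r i x < r i (s j))
    (hne : ∃ x, x ∉ Set.range s) (c : X → I) (hc : ∀ i, c (s i) = i) :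
    ∃ S : Finset X, IsDominantFor r S ∧ S.card = Fintype.card I ∧ S.image c = Finset.univ := by
  classical
  by_contra! hcon
  have hs : Function.Injective s := Function.LeftInverse.injective hc
  have a : I := Classical.arbitrary I
  let R : Finset (Finset X) := Finset.univ.filter fun S =>
    IsDominantFor r S ∧ S.card = Fintype.card I
  let Δ : Finset (Finset X) := Finset.univ.filter fun D =>
    D.image c = Finset.univ.erase a ∧ D.card + 1 = Fintype.card I
  -- Count the pairs `D ⊆ S`. With no colourful `S`, every `S` contributes an even number, while
  -- each `D` contributes zero or two, except the slack facet, which contributes one.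
  have hdc := Finset.sum_card_bipartiteAbove_eq_sum_card_bipartiteBelow (s := Δ) (t := R)
    (fun D S => D ⊆ S)
  have hright : Even (∑ S ∈ R, (Finset.bipartiteBelow (fun D S => D ⊆ S) Δ S).card) := by
    refine Finset.even_sum _ fun S hS => ?_
    simp only [R, Finset.mem_filter, Finset.mem_univ, true_and] at hS
    have := even_card_facets c a hS.2 (hcon S hS.1 hS.2)
    rwa [show Finset.bipartiteBelow (fun D S => D ⊆ S) Δ S = S.powerset.filter fun D =>
      D.image c = Finset.univ.erase a ∧ D.card + 1 = Fintype.card I from ?_]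
    ext D
    simp only [Finset.bipartiteBelow, Δ, Finset.mem_filter, Finset.mem_univ, true_and,
      Finset.mem_powerset]
    tauto
  have hpos : 0 < Fintype.card I := Fintype.card_pos
  have hD₀ : (Finset.univ.erase a).image s ∈ Δ := by
    simp only [Δ, Finset.mem_filter, Finset.mem_univ, true_and]
    constructor
    · rw [Finset.image_image, show c ∘ s = id from funext hc, Finset.image_id]
    · rw [Finset.card_image_of_injective _ hs, Finset.card_erase_of_mem (Finset.mem_univ _),
        Finset.card_univ]
      omega
  rw [← Finset.add_sum_erase _ _ hD₀] at hdc
  have hone : (Finset.bipartiteAbove (fun D S => D ⊆ S) R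
      ((Finset.univ.erase a).image s)).card = 1 := by
    rw [← card_dominant_supersets_slack hr hs hmin htop hne a]
    congr 1
    ext S
    simp [Finset.bipartiteAbove, R]
  have hrest : Even (∑ D ∈ Δ.erase ((Finset.univ.erase a).image s),
      (Finset.bipartiteAbove (fun D S => D ⊆ S) R D).card) := by
    refine Finset.even_sum _ fun D hD => ?_
    obtain ⟨hD₁, hD⟩ := Finset.mem_erase.1 hD
    simp only [Δ, Finset.mem_filter, Finset.mem_univ, true_and] at hD
    rcases Finset.eq_empty_or_nonempty (Finset.bipartiteAbove (fun D S => D ⊆ S) R D) with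
      h | ⟨S, hS⟩
    · rw [h]; simp
    -- Slack points are determined by their colours, so the slack facet is the only one without a
    -- non-slack point. Such an `x` lies below `s j` in every order but `j`, which supplies the
    -- upper points that the count of two requires.
    obtain ⟨x, hxD, hx⟩ : ∃ x ∈ D, x ∉ Set.range s := by
      by_contra! h
      refine hD₁ ?_
      rw [← hD.1, Finset.image_image]
      ext x
      simp only [Finset.mem_image, Function.comp]
      constructor
      · intro hx
        obtain ⟨i, rfl⟩ := h x hx
        exact ⟨s i, hx, by rw [hc]⟩
      · rintro ⟨y, hy, rfl⟩
        obtain ⟨i, rfl⟩ := h y hy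
        rwa [hc]
    simp only [Finset.bipartiteAbove, R, Finset.mem_filter, Finset.mem_univ, true_and] at hS
    have htwo := card_dominant_supersets_eq_two hr (hS.1.1.mono hS.2) ⟨x, hxD⟩ hD.2
      (fun j => ⟨s j, fun i hij => ⟨x, hxD, htop i j x hij hx⟩⟩)
    have : (Finset.bipartiteAbove (fun D S => D ⊆ S) R D).card = 2 := by
      rw [← htwo]
      congr 1
      ext S
      simp [Finset.bipartiteAbove, R]
    rw [this]
    exact even_two
  rw [hone] at hdc
  rw [← hdc, add_comm] at hright
  exact (Nat.even_add_one.1 hright) hrest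

end Scarf

/-! ### Brouwer's theorem on a grid -/

/-- Ties are broken lexicographically by an enumeration of `X`. -/
theorem exists_injective_refinement {X : Type*} [Fintype X] (f : X → ℕ) :
    ∃ r : X → ℕ, Function.Injective r ∧ ∀ x y, f x < f y → r x < r y := by
  let e := Fintype.equivFin X
  have hlt : ∀ x y, f x < f y →
      f x * Fintype.card X + e x < f y * Fintype.card X + e y := by
    intro x y h
    have := (e x).isLt
    have := Nat.mul_le_mul_right (Fintype.card X) (Nat.succ_le_of_lt h)
    rw [Nat.succ_mul] at this
    omega
  refine ⟨fun x => f x * Fintype.card X + e x, fun x y h => ?_, hlt⟩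
  simp only at h
  have hf : f x = f y := by
    rcases lt_trichotomy (f x) (f y) with h' | h' | h'
    · exact absurd h (hlt x y h').ne
    · exact h'
    · exact absurd h (hlt y x h').ne'
  rw [hf] at h
  exact e.injective (Fin.ext (by omega))

/-- If no point of the grid `∑ i, g i = m` exceeds `b` in all the coordinates of `C`, then the sum
of `b` over `C` is nearly `m`. -/
theorem sum_lt_of_not_dominated {I : Type*} [Fintype I] [DecidableEq I] {m : ℕ} {C : Finset I}
    (hC : C.Nonempty) (b : I → ℕ)
    (hb : ∀ g : I → ℕ, ∑ i, g i = m → ∃ i ∈ C, g i ≤ b i) :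
    m < ∑ i ∈ C, b i + C.card := by
  by_contra! h
  obtain ⟨a, ha⟩ := hC
  -- The grid point `b + 1` on `C`, with the surplus `d` added at `a` to reach the sum `m`, beats
  -- `b` everywhere on `C`.
  let d := m - (∑ i ∈ C, b i + C.card)
  obtain ⟨i, hi, hle⟩ := hb (fun i => (if i ∈ C then b i + 1 else 0) + if i = a then d else 0) (by
    rw [Finset.sum_add_distrib, Finset.sum_ite_eq' Finset.univ a]
    simp only [Finset.mem_univ, if_true]
    rw [← Finset.sum_filter, Finset.filter_mem_eq_inter, Finset.univ_inter,
      Finset.sum_add_distrib]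
    simp only [Finset.sum_const, smul_eq_mul, mul_one]
    omega)
  simp only [hi, if_true] at hle
  omega

/-- Discrete form of Brouwer's theorem on the grid `∑ i, g i = m`: for every colouring there are
grid points `h i` clustered around `p` such that `h i` has colour `i` or a small `i`-coordinate. -/
theorem exists_colourful_cluster {I : Type*} [Fintype I] [Nonempty I] (m : ℕ)
    (c : (I → ℕ) → I) :
    ∃ (p : I → ℕ) (h : I → I → ℕ), ∑ l, p l = m ∧ (∀ i, ∑ l, h i l = m) ∧
      (∀ i l, h i l ≤ p l + Fintype.card I ∧ p l ≤ h i l + Fintype.card I) ∧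
      ∀ i, c (h i) = i ∨ h i i ≤ Fintype.card I := by
  classical
  let G := {g : I → ℕ // g ∈ Finset.piAntidiag Finset.univ m}
  let _ : Fintype G := inferInstanceAs (Fintype (Finset.piAntidiag (Finset.univ : Finset I) m))
  have hG : ∀ g : I → ℕ, g ∈ Finset.piAntidiag Finset.univ m ↔ ∑ l, g l = m := by simp
  -- Grid values lie between `1` and `m + 1`, strictly between the two slack values `0` and `m + 2`.
  let f : I → I ⊕ G → ℕ := fun i => Sum.elim (fun j => if i = j then 0 else m + 2) fun g => 1 + g.1 i
  choose r hr hrf using fun i => exists_injective_refinement (f i)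
  have hle : ∀ g : G, ∀ i, g.1 i ≤ m := fun g i =>
    (Finset.single_le_sum (fun _ _ => Nat.zero_le _) (Finset.mem_univ i)).trans_eq ((hG g.1).1 g.2)
  have hmin : ∀ i x, r i (Sum.inl i) ≤ r i x := by
    rintro i (j | g)
    · by_cases hij : i = j
      · rw [hij]
      · exact (hrf i _ _ (by simp [f, hij])).le
    · exact (hrf i _ _ (by simp [f])).le
  have htop : ∀ i j x, i ≠ j → x ∉ Set.range (Sum.inl : I → I ⊕ G) →
      r i x < r i (Sum.inl j) := by
    rintro i j (l | g) hij hx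
    · exact absurd ⟨l, rfl⟩ hx
    · refine hrf i _ _ ?_
      have := hle g i
      simp only [f, Sum.elim_inr, Sum.elim_inl, hij, if_false]
      omega
  obtain ⟨a⟩ := ‹Nonempty I›
  have g₀ : G := ⟨Pi.single a m, (hG _).2 (by simp)⟩
  obtain ⟨S, hS, -, hSc⟩ := exists_colourful_dominant hr hmin htop ⟨Sum.inr g₀, by simp⟩
    (Sum.elim id fun g => c g.1) fun _ => rfl
  let C : Finset I := Finset.univ.filter fun i => Sum.inl i ∉ S
  -- An order whose slack point belongs to `S` cannot witness dominance for a grid point, since that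
  -- slack point lies strictly below it.
  have hdom : ∀ g : I → ℕ, ∑ i, g i = m → ∃ i ∈ C, ∀ x : G, Sum.inr x ∈ S → g i ≤ x.1 i := by
    intro g hg
    obtain ⟨i, hi⟩ := hS (Sum.inr ⟨g, (hG g).2 hg⟩)
    refine ⟨i, ?_, fun x hx => ?_⟩
    · simp only [C, Finset.mem_filter, Finset.mem_univ, true_and]
      exact fun h => absurd (hi _ h) (not_le.2 (hrf i _ _ (by simp [f])))
    · by_contra! h
      exact absurd (hi _ hx) (not_le.2 (hrf i _ _ (by simpa [f] using h)))
  have hC : C.Nonempty := by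
    obtain ⟨i, hi, -⟩ := hdom g₀.1 ((hG _).1 g₀.2)
    exact ⟨i, hi⟩
  have hcol : ∀ i ∈ C, ∃ x : G, Sum.inr x ∈ S ∧ c x.1 = i := by
    intro i hi
    have : i ∈ S.image (Sum.elim id fun g : G => c g.1) := by
      rw [hSc]
      exact Finset.mem_univ i
    obtain ⟨j | x, hx, h⟩ := Finset.mem_image.1 this
    · simp only [Sum.elim_inl, id] at h
      subst h
      exact absurd hx (Finset.mem_filter.1 hi).2
    · exact ⟨x, hx, h⟩
  have hne : (Finset.univ.filter fun x : G => Sum.inr x ∈ S).Nonempty := by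
    obtain ⟨i, hi⟩ := hC
    obtain ⟨x, hx, -⟩ := hcol i hi
    exact ⟨x, by simpa using hx⟩
  choose q hq hqmin using fun i =>
    (Finset.univ.filter fun x : G => Sum.inr x ∈ S).exists_min_image (fun x => x.1 i) hne
  simp only [Finset.mem_filter, Finset.mem_univ, true_and] at hq hqmin
  have hsum : m < ∑ i ∈ C, (q i).1 i + C.card := sum_lt_of_not_dominated hC _ fun g hg =>
    let ⟨i, hi, h⟩ := hdom g hg
    ⟨i, hi, h _ (hq i)⟩
  have hCcard : C.card ≤ Fintype.card I := Finset.card_le_univ C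
  -- On `C` the coordinates of `x` are at least the minima `(q i).1 i`, whose sum exceeds `m -
  -- C.card`. Less than `C.card` of the total `m` is left to distribute.
  have hbound : ∀ x : G, Sum.inr x ∈ S →
      (∀ i ∈ C, x.1 i ≤ (q i).1 i + Fintype.card I) ∧ ∀ i ∉ C, x.1 i ≤ Fintype.card I := by
    intro x hx
    have hxm := (hG _).1 x.2
    constructor
    · intro i hi
      have h1 : ∑ l ∈ C, x.1 l ≤ m :=
        (Finset.sum_le_univ_sum_of_nonneg fun _ => Nat.zero_le _).trans_eq hxm
      have h2 : ∑ l ∈ C.erase i, (q l).1 l ≤ ∑ l ∈ C.erase i, x.1 l :=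
        Finset.sum_le_sum fun l _ => hqmin l x hx
      rw [← Finset.add_sum_erase C _ hi] at h1 hsum
      omega
    · intro i hi
      have h1 : ∑ l ∈ insert i C, x.1 l ≤ m :=
        (Finset.sum_le_univ_sum_of_nonneg fun _ => Nat.zero_le _).trans_eq hxm
      rw [Finset.sum_insert hi] at h1
      have h2 : ∑ l ∈ C, (q l).1 l ≤ ∑ l ∈ C, x.1 l := Finset.sum_le_sum fun l _ => hqmin l x hx
      omega
  have hclose : ∀ x y : G, Sum.inr x ∈ S → Sum.inr y ∈ S → ∀ l,
      x.1 l ≤ y.1 l + Fintype.card I := by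
    intro x y hx hy l
    by_cases hl : l ∈ C
    · exact ((hbound x hx).1 l hl).trans (Nat.add_le_add_right (hqmin l y hy) _)
    · exact ((hbound x hx).2 l hl).trans (Nat.le_add_left _ _)
  have hchoose : ∀ i, ∃ x : G, Sum.inr x ∈ S ∧ (c x.1 = i ∨ x.1 i ≤ Fintype.card I) := by
    intro i
    by_cases hi : i ∈ C
    · obtain ⟨x, hx, h⟩ := hcol i hi
      exact ⟨x, hx, Or.inl h⟩
    · exact ⟨q i, hq i, Or.inr ((hbound _ (hq i)).2 i hi)⟩
  choose h hhS hh using hchoose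
  exact ⟨(h a).1, fun i => (h i).1, (hG _).1 (h a).2, fun i => (hG _).1 (h i).2,
    fun i l => ⟨hclose _ _ (hhS i) (hhS a) l, hclose _ _ (hhS a) (hhS i) l⟩, hh⟩

/-! ### Brouwer's theorem by refinement of the grid -/

/-- **Brouwer's fixed point theorem** on the standard simplex. -/
theorem exists_fixedPoint_stdSimplex {I : Type*} [Fintype I] [Nonempty I]
    {f : (I → ℝ) → I → ℝ} (hf : ContinuousOn f (stdSimplex ℝ I))
    (hmaps : MapsTo f (stdSimplex ℝ I) (stdSimplex ℝ I)) : ∃ x ∈ stdSimplex ℝ I, f x = x := by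
  -- Both `x` and `f x` have coordinate sum one, so `f x` cannot be smaller in every coordinate.
  have hcol : ∀ x, ∃ i, x ∈ stdSimplex ℝ I → x i ≤ f x i := by
    intro x
    by_contra! h
    obtain ⟨a⟩ := ‹Nonempty I›
    have hx := (h a).1
    have := Finset.sum_lt_sum_of_nonempty (s := Finset.univ) ⟨a, Finset.mem_univ a⟩
      fun i _ => (h i).2
    rw [(hmaps hx).2, hx.2] at this
    exact lt_irrefl _ this
  choose col hcol using hcol
  let n : ℝ := Fintype.card I
  let sc : ℕ → (I → ℕ) → I → ℝ := fun m g i => g i / ((m : ℝ) + 1)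
  have hsc : ∀ m g, ∑ i, g i = m + 1 → sc m g ∈ stdSimplex ℝ I := by
    intro m g hg
    refine ⟨fun i => by positivity, ?_⟩
    rw [← Finset.sum_div, div_eq_one_iff_eq (by positivity)]
    exact_mod_cast hg
  choose p h hp hh hclose hc using fun m : ℕ =>
    exists_colourful_cluster (m + 1) fun g => col (sc m g)
  obtain ⟨x, hx, ψ, hψ, hlim⟩ := (isCompact_stdSimplex ℝ I).tendsto_subseq
    fun m => hsc m (p m) (hp m)
  have hsmall : Tendsto (fun k => n / ((ψ k : ℝ) + 1)) atTop (𝓝 0) :=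
    (tendsto_const_div_atTop_nhds_zero_nat n |>.comp (tendsto_add_atTop_nat 1) |>.comp
      hψ.tendsto_atTop).congr fun k => by simp
  have hlim' : ∀ i, Tendsto (fun k => sc (ψ k) (h (ψ k) i)) atTop (𝓝 x) := by
    intro i
    rw [tendsto_pi_nhds] at hlim ⊢
    intro l
    have h0 : Tendsto (fun k => sc (ψ k) (h (ψ k) i) l - sc (ψ k) (p (ψ k)) l) atTop (𝓝 0) := by
      refine squeeze_zero_norm (fun k => ?_) hsmall
      rw [Real.norm_eq_abs]
      simp only [sc]
      rw [← sub_div, abs_div, abs_of_pos (show (0 : ℝ) < (ψ k : ℝ) + 1 by positivity)]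
      gcongr
      rw [abs_le]
      obtain ⟨h1, h2⟩ := hclose (ψ k) i l
      have h1' : (h (ψ k) i l : ℝ) ≤ p (ψ k) l + n := by simp only [n]; exact_mod_cast h1
      have h2' : (p (ψ k) l : ℝ) ≤ h (ψ k) i l + n := by simp only [n]; exact_mod_cast h2
      constructor <;> linarith
    simpa using h0.add (hlim l)
  have hmem : ∀ i k, sc (ψ k) (h (ψ k) i) ∈ stdSimplex ℝ I := fun i k => hsc _ _ (hh _ i)
  -- The points `h (ψ k) i` tend to `x` and satisfy the inequality up to `n / (ψ k + 1)`: either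
  -- through their colour, or because their `i`-coordinate is that small and `f` is nonnegative.
  have hle : ∀ i, x i ≤ f x i := by
    intro i
    have hfl : Tendsto (fun k => f (sc (ψ k) (h (ψ k) i))) atTop (𝓝 (f x)) :=
      (hf x hx).tendsto.comp (tendsto_nhdsWithin_iff.2
        ⟨hlim' i, Eventually.of_forall fun k => hmem i k⟩)
    have h1 := ((tendsto_pi_nhds.1 hfl) i).add hsmall
    rw [add_zero] at h1
    refine le_of_tendsto_of_tendsto' ((tendsto_pi_nhds.1 (hlim' i)) i) h1 fun k => ?_
    rcases hc (ψ k) i with hci | hci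
    · have h2 := hcol _ (hmem i k)
      rw [hci] at h2
      have : 0 ≤ n / ((ψ k : ℝ) + 1) := by positivity
      linarith
    · have h2 := (hmaps (hmem i k)).1 i
      have : sc (ψ k) (h (ψ k) i) i ≤ n / ((ψ k : ℝ) + 1) := by
        simp only [sc, n]
        gcongr
      linarith
  refine ⟨x, hx, funext fun i => ?_⟩
  refine ((Finset.sum_eq_sum_iff_of_le fun i _ => hle i).1 ?_ i (Finset.mem_univ i)).symm
  rw [(hmaps hx).2, hx.2]

/-! ### Schauder's theorem by finite-dimensional approximation -/

/-- **Schauder's fixed point theorem**, approximate form. -/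
theorem exists_almost_fixedPoint {E : Type*} [NormedAddCommGroup E] [NormedSpace ℝ E] {K : Set E}
    (hK : IsCompact K) (hconv : Convex ℝ K) (hne : K.Nonempty) {T : E → E}
    (hT : ContinuousOn T K) (hmaps : MapsTo T K K) {ε : ℝ} (hε : 0 < ε) :
    ∃ x ∈ K, ‖T x - x‖ ≤ ε := by
  obtain ⟨t, htK, htfin, hcover⟩ := finite_cover_balls_of_compact hK hε
  have : Fintype t := htfin.fintype
  have : Nonempty t := by
    obtain ⟨z, hz⟩ := hne
    obtain ⟨y, hy, -⟩ := mem_iUnion₂.1 (hcover hz)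
    exact ⟨⟨y, hy⟩⟩
  -- Normalized, these weights form a partition of unity in which `y` counts only at points within
  -- `ε` of it, so averaging the net moves points of `K` by at most `ε`.
  let w : E → t → ℝ := fun z y => max 0 (ε - dist z y)
  have hw0 : ∀ z y, 0 ≤ w z y := fun z y => le_max_left _ _
  have hwpos : ∀ z ∈ K, 0 < ∑ y, w z y := by
    intro z hz
    obtain ⟨y, hy, hzy⟩ := mem_iUnion₂.1 (hcover hz)
    refine Finset.sum_pos' (fun y _ => hw0 z y) ⟨⟨y, hy⟩, Finset.mem_univ _, ?_⟩
    exact lt_max_of_lt_right (sub_pos.2 hzy)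
  have hwc : ∀ y, Continuous fun z => w z y := fun y => by simp only [w]; fun_prop
  let proj : E → t → ℝ := fun z y => w z y / ∑ y, w z y
  have hproj : MapsTo proj K (stdSimplex ℝ t) := fun z hz =>
    ⟨fun y => div_nonneg (hw0 z y) (hwpos z hz).le, by
      simp only [proj]
      rw [← Finset.sum_div, div_self (hwpos z hz).ne']⟩
  have hprojc : ContinuousOn proj K := continuousOn_pi.2 fun y =>
    (hwc y).continuousOn.div (continuous_finsetSum _ fun y _ => hwc y).continuousOn
      fun z hz => (hwpos z hz).ne'
  let bary : (t → ℝ) → E := fun a => ∑ y, a y • (y : E)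
  have hbary : MapsTo bary (stdSimplex ℝ t) K := fun a ha =>
    hconv.sum_mem (fun y _ => ha.1 y) ha.2 fun y _ => htK y.2
  have hbaryc : Continuous bary := by simp only [bary]; fun_prop
  have hnear : ∀ z ∈ K, ‖z - bary (proj z)‖ ≤ ε := by
    intro z hz
    have h1 : z - bary (proj z) = ∑ y, proj z y • (z - (y : E)) := by
      simp only [smul_sub, Finset.sum_sub_distrib, bary]
      rw [← Finset.sum_smul, (hproj hz).2, one_smul]
    rw [h1]
    calc ‖∑ y, proj z y • (z - (y : E))‖ ≤ ∑ y, proj z y * ε := by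
          refine norm_sum_le_of_le _ fun y _ => ?_
          rw [norm_smul, Real.norm_eq_abs, abs_of_nonneg ((hproj hz).1 y)]
          by_cases hy : dist z y < ε
          · rw [← dist_eq_norm]
            exact mul_le_mul_of_nonneg_left hy.le ((hproj hz).1 y)
          · have : proj z y = 0 := by
              simp only [proj, w]
              rw [max_eq_left (by linarith), zero_div]
            simp [this]
      _ = ε := by rw [← Finset.sum_mul, (hproj hz).2, one_mul]
  -- If `a` is fixed, then `bary a` is the Schauder projection of `T (bary a)`, hence within `ε` of
  -- it.
  obtain ⟨a, ha, hfix⟩ := exists_fixedPoint_stdSimplex (f := fun a => proj (T (bary a)))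
    (hprojc.comp (hT.comp hbaryc.continuousOn hbary) fun a ha => hmaps (hbary ha))
    fun a ha => hproj (hmaps (hbary ha))
  refine ⟨bary a, hbary ha, ?_⟩
  have := hnear (T (bary a)) (hmaps (hbary ha))
  rwa [hfix] at this

/-- **Schauder's fixed point theorem**. -/
theorem exists_fixedPoint_of_isCompact_convex {E : Type*} [NormedAddCommGroup E]
    [NormedSpace ℝ E] {K : Set E} (hK : IsCompact K) (hconv : Convex ℝ K) (hne : K.Nonempty)
    {T : E → E} (hT : ContinuousOn T K) (hmaps : MapsTo T K K) : ∃ x ∈ K, T x = x := by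
  -- Compactness turns approximate fixed points into an exact one: the displacement attains its
  -- minimum, which is below every `ε`.
  obtain ⟨x, hx, hmin⟩ := hK.exists_isMinOn hne (hT.sub continuousOn_id).norm
  refine ⟨x, hx, ?_⟩
  rw [← sub_eq_zero, ← norm_le_zero_iff]
  refine le_of_forall_pos_le_add fun ε hε => ?_
  obtain ⟨y, hy, hyε⟩ := exists_almost_fixedPoint hK hconv hne hT hmaps hε
  rw [zero_add]
  exact (hmin hy).trans hyε

/-! ### Iterated closed convex hulls and the fixed point -/

theorem mainTheorem1 {E : Type*} [NormedAddCommGroup E] [NormedSpace ℝ E] [CompleteSpace E]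
    (A : Set E) (hAne : A.Nonempty) (hAcl : IsClosed A) (hAbd : Bornology.IsBounded A)
    (hAconv : Convex ℝ A)
    (μ : Set E → ℝ) (hμ : IsMeasureOfNoncompactness μ)
    (T : E → E) (hTmaps : MapsTo T A A) (hTcont : ContinuousOn T A)
    (Ψ : ℝ → ℝ) (hΨnonneg : ∀ t, 0 ≤ t → 0 ≤ Ψ t) (hΨmono : MonotoneOn Ψ (Ici 0))
    (hΨconc : ConcaveOn ℝ (Ici 0) Ψ)
    (hΨiter : ∀ t, 0 ≤ t → Tendsto (fun n : ℕ => Ψ^[n] t) atTop (𝓝 0))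
    (Φ : ℝ → ℝ) (hΦnonneg : ∀ t, 0 ≤ t → 0 ≤ Φ t) (hΦmono : MonotoneOn Φ (Ici 0))
    (hΦsub : ∀ s t, 0 ≤ s → 0 ≤ t → Φ (s + t) ≤ Φ s + Φ t)
    (hΦge : ∀ t, 0 ≤ t → t ≤ Φ t)
    (hΦlim : ∀ x : ℕ → ℝ, (∀ n, 0 ≤ x n) →
      (Tendsto (fun n => Φ (x n)) atTop (𝓝 0) ↔ Tendsto x atTop (𝓝 0)))
    (φ : ℝ → ℝ) (hφnonneg : ∀ t, 0 ≤ t → 0 ≤ φ t)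
    (hφint : ∀ K : Set ℝ, K ⊆ Ici 0 → IsCompact K → IntegrableOn φ K)
    (hφpos : ∀ ε : ℝ, 0 < ε → 0 < ∫ γ in (0 : ℝ)..ε, φ γ)
    (hineq : ∀ Y : Set E, Y ⊆ A → Y.Nonempty →
      Φ (∫ γ in (0 : ℝ)..μ (T '' Y), φ γ) ≤ Ψ (∫ γ in (0 : ℝ)..μ Y, φ γ)) :
    ∃ x ∈ A, T x = x := by
  let I : ℝ → ℝ := fun t => ∫ γ in (0 : ℝ)..t, φ γ
  have hint : ∀ t, 0 ≤ t → IntervalIntegrable φ volume 0 t := fun t ht =>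
    (intervalIntegrable_iff_integrableOn_Icc_of_le ht).2 (hφint _ Icc_subset_Ici_self isCompact_Icc)
  have hI0 : ∀ t, 0 ≤ t → 0 ≤ I t := fun t ht =>
    intervalIntegral.integral_nonneg ht fun u hu => hφnonneg u hu.1
  have hImono : ∀ s t, 0 ≤ s → s ≤ t → I s ≤ I t := fun s t hs hst =>
    intervalIntegral.integral_mono_interval le_rfl hs hst
      ((ae_restrict_iff' measurableSet_Ioc).2 (Eventually.of_forall fun u hu => hφnonneg u hu.1.le))
      (hint t (hs.trans hst))
  let B : ℕ → Set E := fun n => (fun Y => closedConvexHull ℝ (T '' Y))^[n] A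
  have hBsucc : ∀ n, B (n + 1) = closedConvexHull ℝ (T '' B n) := fun n =>
    Function.iterate_succ_apply' _ _ _
  have hBanti : ∀ n, B (n + 1) ⊆ B n := by
    intro n
    induction n with
    | zero =>
      rw [hBsucc]
      exact closedConvexHull_min hTmaps.image_subset hAconv hAcl
    | succ n ih =>
      rw [hBsucc (n + 1)]
      conv_rhs => rw [hBsucc n]
      exact (closedConvexHull ℝ).monotone (image_mono ih)
  have hBA : ∀ n, B n ⊆ A := fun n => antitone_nat_of_succ_le hBanti (Nat.zero_le n)
  have hBne : ∀ n, (B n).Nonempty := by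
    intro n
    induction n with
    | zero => exact hAne
    | succ n ih =>
      rw [hBsucc]
      exact (ih.image T).mono subset_closedConvexHull
  have hBcl : ∀ n, IsClosed (B n) := by
    rintro (_ | n)
    · exact hAcl
    · rw [hBsucc]
      exact isClosed_closedConvexHull
  have hBconv : ∀ n, Convex ℝ (B n) := by
    rintro (_ | n)
    · exact hAconv
    · rw [hBsucc]
      exact convex_closedConvexHull
  have hBbd : ∀ n, Bornology.IsBounded (B n) := fun n => hAbd.subset (hBA n)
  have hμ0 : ∀ n, 0 ≤ μ (B n) := fun n => hμ.nonneg _ (hBne n) (hBbd n)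
  have hstep : ∀ n, I (μ (B (n + 1))) ≤ Ψ (I (μ (B n))) := by
    intro n
    have hTbd : Bornology.IsBounded (T '' B n) :=
      hAbd.subset ((hTmaps.mono_left (hBA n)).image_subset)
    rw [hBsucc, hμ.closedConvexHull_eq _ ((hBne n).image T) hTbd]
    exact (hΦge _ (hI0 _ (hμ.nonneg _ ((hBne n).image T) hTbd))).trans
      (hineq _ (hBA n) (hBne n))
  have hbound : ∀ n, I (μ (B n)) ≤ Ψ^[n] (I (μ A)) := by
    intro n
    induction n with
    | zero => exact le_rfl
    | succ n ih =>
      rw [Function.iterate_succ_apply']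
      exact (hstep n).trans (hΨmono (hI0 _ (hμ0 n)) ((hI0 _ (hμ0 n)).trans ih) ih)
  have hIlim : Tendsto (fun n => I (μ (B n))) atTop (𝓝 0) :=
    squeeze_zero (fun n => hI0 _ (hμ0 n)) hbound (hΨiter _ (hI0 _ (hμ0 0)))
  -- If `μ (B n) ≥ ε`, then `I (μ (B n)) ≥ I ε > 0`, which fails for large `n`.
  have hμlim : Tendsto (fun n => μ (B n)) atTop (𝓝 0) := by
    refine tendsto_order.2 ⟨fun a ha => Eventually.of_forall fun n => ha.trans_le (hμ0 n),
      fun ε hε => ?_⟩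
    filter_upwards [hIlim.eventually (gt_mem_nhds (hφpos ε hε))] with n hn
    by_contra! h
    exact absurd hn (not_lt.2 (hImono ε _ hε.le h))
  obtain ⟨hne, hcomp⟩ := hμ.iInter_nonempty B hBne hBbd hBcl hBanti hμlim
  rw [(isClosed_iInter hBcl).closure_eq] at hcomp
  have hsub : (⋂ n, B n) ⊆ A := iInter_subset B 0
  -- Invariance of the intersection: a point of `B n` has its image in `B (n + 1) ⊆ B n`.
  obtain ⟨x, hx, hfix⟩ := exists_fixedPoint_of_isCompact_convex hcomp (convex_iInter hBconv) hne
    (hTcont.mono hsub) fun x hx => mem_iInter.2 fun n => hBanti n (by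
      rw [hBsucc]
      exact subset_closedConvexHull (mem_image_of_mem T (mem_iInter.1 hx n)))
  exact ⟨x, hsub hx, hfix⟩
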